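/- Let $U,V$ be linear subspaces of the Euclidean space $\mathbb{R}^n$ with $1\le \dim U\le \dim V\le n-1$, $U\ne U\cap V$ and $U\cap V\ne\{0\}$. Let $\theta_F\in(0,\pi/2]$ be their Friedrichs angle, that is, $$\cos\theta_F=\sup\{\langle u,v\rangle : u\in U\cap(U\cap V)^\perp,\ v\in V\cap(U\cap V)^\perp,\ \|u\|\le 1,\ \|v\|\le 1\}.$$ With $P_U,P_V$ the orthogonal projectors onto $U$ and $V$, put, for $\alpha\in(0,1]$ and $\beta\in(0,1)$, $$T_{\alpha,\beta}:=(1-\alpha)I+\alpha(2\beta P_V-I)(2\beta P_U-I).$$ A number $\mu\in[0,1)$ is a linear convergence rate of a matrix $A\in\mathbb{C}^{n\times n}$ if there are a matrix $A^\infty\in\mathbb{C}^{n\times n}$, an integer $k_0\ge 1$ and some $M>0$ such that $\|A^k-A^\infty\|\le M\mu^k$ for all $k\ge k_0$, where $\|\cdot\|$ is the matrix norm induced by the Euclidean norm; if the infimum of all linear convergence rates of $A$ is itself a linear convergence rate, it is called the optimal linear convergence rate of $A$. Write $\gamma(A):=\max\{|\lambda| : \lambda\in\{0\}\cup(\sigma(A)\setminus\{1\})\}$,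 where $\sigma(A)\subset\mathbb{C}$ is the set of eigenvalues of $A$. Then, for all $(\alpha,\beta)\in(0,1]\times(0,1)$, the infimum of the linear convergence rates of $T_{\alpha,\beta}$ is $\gamma(T_{\alpha,\beta})$, and it attains its smallest value at $\alpha^\star=1$ and $\beta^\star=\frac{1}{1+\sin\theta_F}\in(0,1)$; that is, $$\frac{1-\sin\theta_F}{1+\sin\theta_F}=\gamma(T_{1,\beta^\star})\le\gamma(T_{\alpha,\beta})\qquad\text{for all }(\alpha,\beta)\in(0,1]\times(0,1).$$ Furthermore, $\gamma(T_{1,\beta^\star})$ is an optimal linear convergence rate of $T_{1,\beta^\star}$ if and only if $\theta_F=\frac{\pi}{2}$. -/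

import Mathlib

noncomputable section

/-- The Euclidean space `ℝⁿ`. -/
abbrev En (n : ℕ) : Type := EuclideanSpace ℝ (Fin n)

/-- The cosine `c_F(U, V)` of the Friedrichs angle: the supremum of `⟪u, v⟫` over `u` and `v` in the
unit balls of `U ∩ (U ∩ V)ᗮ` and `V ∩ (U ∩ V)ᗮ`. -/
def friedrichsCos {n : ℕ} (U V : Submodule ℝ (En n)) : ℝ :=
  sSup {c : ℝ | ∃ u ∈ U ⊓ (U ⊓ V)ᗮ, ∃ v ∈ V ⊓ (U ⊓ V)ᗮ, ‖u‖ ≤ 1 ∧ ‖v‖ ≤ 1 ∧ c = inner ℝ u v}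

/-- The Friedrichs angle `θ_F`. -/
def friedrichsAngle {n : ℕ} (U V : Submodule ℝ (En n)) : ℝ :=
  Real.arccos (friedrichsCos U V)

/-- The matrix, in the standard basis, of the orthogonal projector onto `U`. -/
def projMatrix {n : ℕ} (U : Submodule ℝ (En n)) : Matrix (Fin n) (Fin n) ℝ :=
  (Matrix.toEuclideanCLM (n := Fin n) (𝕜 := ℝ)).symm U.starProjection

/-- The averaged alternating modified reflections operator
`T_{α,β} = (1 - α) I + α (2 β P_V - I) (2 β P_U - I)`, as a real matrix. -/
def aamrReal {n : ℕ} (U V : Submodule ℝ (En n)) (α β : ℝ) : Matrix (Fin n) (Fin n) ℝ :=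
  (1 - α) • (1 : Matrix (Fin n) (Fin n) ℝ) +
    α • (((2 * β) • projMatrix V - 1) * ((2 * β) • projMatrix U - 1))

/-- The operator `T_{α,β}` as a matrix with complex entries. -/
def aamr {n : ℕ} (U V : Submodule ℝ (En n)) (α β : ℝ) : Matrix (Fin n) (Fin n) ℂ :=
  (aamrReal U V α β).map Complex.ofReal

/-- The matrix norm induced by the Euclidean norm of `ℂⁿ`. -/
def inducedNorm {n : ℕ} (A : Matrix (Fin n) (Fin n) ℂ) : ℝ :=
  ‖Matrix.toEuclideanCLM (n := Fin n) (𝕜 := ℂ) A‖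

/-- `A` is linearly convergent to `B` with rate `μ ∈ [0, 1)`. -/
def LinearlyConvergentTo {n : ℕ} (A B : Matrix (Fin n) (Fin n) ℂ) (μ : ℝ) : Prop :=
  0 ≤ μ ∧ μ < 1 ∧ ∃ k₀ : ℕ, 0 < k₀ ∧ ∃ M : ℝ, 0 < M ∧
    ∀ k : ℕ, k₀ ≤ k → inducedNorm (A ^ k - B) ≤ M * μ ^ k

/-- The set of all linear convergence rates of `A`. -/
def linearRates {n : ℕ} (A : Matrix (Fin n) (Fin n) ℂ) : Set ℝ :=
  {μ | ∃ B : Matrix (Fin n) (Fin n) ℂ, LinearlyConvergentTo A B μ}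

/-- `μ` is the optimal linear convergence rate of `A`: the infimum of the rates, and itself a
rate. -/
def IsOptimalLinearRate {n : ℕ} (A : Matrix (Fin n) (Fin n) ℂ) (μ : ℝ) : Prop :=
  IsGLB (linearRates A) μ ∧ μ ∈ linearRates A

/-- `γ(A) = max {|z| : z ∈ {0} ∪ (σ(A) \ {1})}`; the set is finite and non-empty, so that its
supremum is its maximum. -/
def subdominant {n : ℕ} (A : Matrix (Fin n) (Fin n) ℂ) : ℝ :=
  sSup ((fun z : ℂ => ‖z‖) '' ({0} ∪ (spectrum ℂ A \ {1})))

end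

/-! Write c = cos θ_F, s = sin θ_F and ρ = (1 - s)/(1 + s).

Rates. A modified reflection loses 4β(1 - β)‖Px‖² of squared norm, so `T_{α,β}` strictly shrinks
every vector outside the complexification of Uᗮ ∩ Vᗮ, on which it is the identity. If B is the
projector onto that space, T^k - B = (T - B)^k for k ≥ 1, and Gelfand's formula makes every number
in (γ, 1) a rate. Conversely, an eigenvalue z ≠ 1 is bounded by every rate
(`isGLB_linearRates_aamr`).

Lower bound. If c > 0, unit principal vectors u, v with P_V u = c v and P_U v = c u span an
invariant plane. The eigenvalues there are 1 - α + α(βc ± w)², with w² = β²c² - 2β + 1. A case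
analysis gives one of them modulus at least ρ for all (α, β)
(`exists_friedrichs_eigenvalue_norm_ge`).

Attainment. At α = 1 and β = 1/(1 + s) the discriminant w² vanishes and both eigenvalues equal ρ =
β²c² = 2β - 1. Any other eigenvalue reduces to an eigenvalue of P_U P_V, which is 1 or at most c²
(`subdominant_aamr_le_of_pos`).

Optimality. If c > 0, the double eigenvalue ρ carries a Jordan block, so the error decays like kρ^k
and ρ is not a rate. If c = 0, the projectors commute, T is idempotent and 0 is a rate. -/

/-! ### The Friedrichs angle -/

section Friedrichs

variable {n : ℕ} (U V : Submodule ℝ (En n))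

/-- The set of inner products defining the cosine of the Friedrichs angle is the image of a compact
set under the inner product. -/
theorem friedrichsSet_eq_image :
    {c : ℝ | ∃ u ∈ U ⊓ (U ⊓ V)ᗮ, ∃ v ∈ V ⊓ (U ⊓ V)ᗮ, ‖u‖ ≤ 1 ∧ ‖v‖ ≤ 1 ∧ c = inner ℝ u v} =
      (fun p : En n × En n => inner ℝ p.1 p.2) ''
        ((((U ⊓ (U ⊓ V)ᗮ : Submodule ℝ (En n)) : Set (En n)) ∩ Metric.closedBall 0 1) ×ˢ
          (((V ⊓ (U ⊓ V)ᗮ : Submodule ℝ (En n)) : Set (En n)) ∩ Metric.closedBall 0 1)) := by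
  ext c
  constructor
  · rintro ⟨u, hu, v, hv, hu1, hv1, rfl⟩
    exact ⟨(u, v), ⟨⟨hu, by simpa using hu1⟩, ⟨hv, by simpa using hv1⟩⟩, rfl⟩
  · rintro ⟨⟨u, v⟩, ⟨⟨hu, hu1⟩, ⟨hv, hv1⟩⟩, rfl⟩
    exact ⟨u, hu, v, hv, by simpa using hu1, by simpa using hv1, rfl⟩

/-- Compactness makes the supremum a maximum; boundedness also ensures that `sSup` does not take its
default value. -/
theorem isCompact_friedrichsSet :
    IsCompact {c : ℝ | ∃ u ∈ U ⊓ (U ⊓ V)ᗮ, ∃ v ∈ V ⊓ (U ⊓ V)ᗮ,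
      ‖u‖ ≤ 1 ∧ ‖v‖ ≤ 1 ∧ c = inner ℝ u v} := by
  rw [friedrichsSet_eq_image]
  refine IsCompact.image (IsCompact.prod ?_ ?_) (by fun_prop)
  · exact (isCompact_closedBall _ _).inter_left (Submodule.closed_of_finiteDimensional _)
  · exact (isCompact_closedBall _ _).inter_left (Submodule.closed_of_finiteDimensional _)

theorem exists_inner_eq_friedrichsCos :
    ∃ u ∈ U ⊓ (U ⊓ V)ᗮ, ∃ v ∈ V ⊓ (U ⊓ V)ᗮ,
      ‖u‖ ≤ 1 ∧ ‖v‖ ≤ 1 ∧ friedrichsCos U V = inner ℝ u v :=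
  (isCompact_friedrichsSet U V).sSup_mem
    ⟨0, 0, zero_mem _, 0, zero_mem _, by simp, by simp, by simp⟩

variable {U V}

theorem inner_le_friedrichsCos {u v : En n} (hu : u ∈ U ⊓ (U ⊓ V)ᗮ) (hv : v ∈ V ⊓ (U ⊓ V)ᗮ)
    (hu1 : ‖u‖ ≤ 1) (hv1 : ‖v‖ ≤ 1) : inner ℝ u v ≤ friedrichsCos U V :=
  le_csSup (isCompact_friedrichsSet U V).bddAbove ⟨u, hu, v, hv, hu1, hv1, rfl⟩

variable (U V) in
theorem friedrichsCos_nonneg : 0 ≤ friedrichsCos U V := by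
  simpa using inner_le_friedrichsCos (U := U) (V := V) (u := 0) (v := 0) (zero_mem _) (zero_mem _)
    (by simp) (by simp)

variable (U V) in
theorem friedrichsCos_comm : friedrichsCos U V = friedrichsCos V U := by
  unfold friedrichsCos
  congr 1
  ext c
  rw [inf_comm U V]
  constructor
  · rintro ⟨u, hu, v, hv, hu1, hv1, rfl⟩
    exact ⟨v, hv, u, hu, hv1, hu1, real_inner_comm _ _⟩
  · rintro ⟨u, hu, v, hv, hu1, hv1, rfl⟩
    exact ⟨v, hv, u, hu, hv1, hu1, real_inner_comm _ _⟩

theorem inner_le_friedrichsCos_mul {u v : En n} (hu : u ∈ U ⊓ (U ⊓ V)ᗮ)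
    (hv : v ∈ V ⊓ (U ⊓ V)ᗮ) : inner ℝ u v ≤ friedrichsCos U V * (‖u‖ * ‖v‖) := by
  rcases eq_or_ne u 0 with rfl | hu0
  · simp
  rcases eq_or_ne v 0 with rfl | hv0
  · simp
  have h := inner_le_friedrichsCos (Submodule.smul_mem _ ‖u‖⁻¹ hu)
    (Submodule.smul_mem _ ‖v‖⁻¹ hv) (by simp [norm_smul, hu0]) (by simp [norm_smul, hv0])
  rw [real_inner_smul_left, real_inner_smul_right] at h
  have h1 : 0 < ‖u‖ := norm_pos_iff.2 hu0
  have h2 : 0 < ‖v‖ := norm_pos_iff.2 hv0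
  calc inner ℝ u v = (‖u‖⁻¹ * (‖v‖⁻¹ * inner ℝ u v)) * (‖u‖ * ‖v‖) := by field_simp
    _ ≤ _ := by gcongr

theorem inner_starProjection_self (V : Submodule ℝ (En n)) (u : En n) :
    inner ℝ u (V.starProjection u) = ‖V.starProjection u‖ ^ 2 := by
  rw [← real_inner_self_eq_norm_sq, Submodule.inner_starProjection_left_eq_right,
    Submodule.starProjection_eq_self_iff.2 (Submodule.starProjection_apply_mem _ _)]

/-- P_V is self-adjoint and fixes U ∩ V, hence it preserves the orthogonal complement. -/
theorem starProjection_mem_inf_orthogonal {u : En n} (hu : u ∈ (U ⊓ V)ᗮ) :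
    V.starProjection u ∈ V ⊓ (U ⊓ V)ᗮ := by
  refine ⟨Submodule.starProjection_apply_mem _ _, fun w hw => ?_⟩
  rw [← Submodule.inner_starProjection_left_eq_right,
    Submodule.starProjection_eq_self_iff.2 hw.2]
  exact hu w hw

/-- The pair (u, P_V u) is admissible and its inner product is ‖P_V u‖²; divide by ‖P_V u‖. -/
theorem norm_starProjection_le_friedrichsCos_mul {u : En n} (hu : u ∈ U ⊓ (U ⊓ V)ᗮ) :
    ‖V.starProjection u‖ ≤ friedrichsCos U V * ‖u‖ := by
  have h := inner_le_friedrichsCos_mul hu (starProjection_mem_inf_orthogonal hu.2)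
  rw [inner_starProjection_self] at h
  rcases eq_or_ne ‖V.starProjection u‖ 0 with h0 | h0
  · rw [h0]; exact mul_nonneg (friedrichsCos_nonneg U V) (norm_nonneg _)
  have : 0 < ‖V.starProjection u‖ := lt_of_le_of_ne (norm_nonneg _) (Ne.symm h0)
  nlinarith

theorem norm_starProjection_le_friedrichsCos_mul' {v : En n} (hv : v ∈ V ⊓ (U ⊓ V)ᗮ) :
    ‖U.starProjection v‖ ≤ friedrichsCos U V * ‖v‖ := by
  rw [friedrichsCos_comm]
  rw [inf_comm U V] at hv
  exact norm_starProjection_le_friedrichsCos_mul hv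

/-- If the Friedrichs angle is not right, it is realized by a pair of principal vectors. -/
theorem exists_principal_vectors (hc : 0 < friedrichsCos U V) :
    ∃ u ∈ U ⊓ (U ⊓ V)ᗮ, ∃ v ∈ V ⊓ (U ⊓ V)ᗮ, ‖u‖ = 1 ∧ ‖v‖ = 1 ∧
      V.starProjection u = friedrichsCos U V • v ∧ U.starProjection v = friedrichsCos U V • u := by
  obtain ⟨u, hu, v, hv, hu1, hv1, huv⟩ := exists_inner_eq_friedrichsCos U V
  have hle := inner_le_friedrichsCos_mul hu hv
  set c := friedrichsCos U V with hcdef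
  -- A maximizing pair satisfies c ≤ c‖u‖‖v‖ with c > 0, so both vectors are unit.
  have h1 : 1 ≤ ‖u‖ * ‖v‖ := by
    by_contra! h
    nlinarith
  have hnu : ‖u‖ = 1 := by nlinarith [norm_nonneg u, norm_nonneg v]
  have hnv : ‖v‖ = 1 := by nlinarith [norm_nonneg u, norm_nonneg v]
  refine ⟨u, hu, v, hv, hnu, hnv, ?_, ?_⟩
  · have hp := norm_starProjection_le_friedrichsCos_mul hu
    rw [hnu, mul_one, ← hcdef] at hp
    have hi : inner ℝ (V.starProjection u) v = c := by
      rw [Submodule.inner_starProjection_left_eq_right,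
        Submodule.starProjection_eq_self_iff.2 hv.1, huv]
    -- ‖P_V u - c v‖² = ‖P_V u‖² - c², which is at most 0.
    rw [← sub_eq_zero, ← norm_eq_zero, ← sq_eq_zero_iff]
    refine le_antisymm ?_ (sq_nonneg _)
    rw [norm_sub_sq_real, norm_smul, hnv, real_inner_smul_right, hi, Real.norm_of_nonneg hc.le]
    nlinarith [norm_nonneg (V.starProjection u)]
  · have hp := norm_starProjection_le_friedrichsCos_mul' hv
    rw [hnv, mul_one, ← hcdef] at hp
    have hi : inner ℝ (U.starProjection v) u = c := by
      rw [Submodule.inner_starProjection_left_eq_right,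
        Submodule.starProjection_eq_self_iff.2 hu.1, huv, real_inner_comm]
    rw [← sub_eq_zero, ← norm_eq_zero, ← sq_eq_zero_iff]
    refine le_antisymm ?_ (sq_nonneg _)
    rw [norm_sub_sq_real, norm_smul, hnu, real_inner_smul_right, hi, Real.norm_of_nonneg hc.le]
    nlinarith [norm_nonneg (U.starProjection v)]

-- If c ≥ 1, the principal vectors satisfy P_V u = v and ⟨u, v⟩ = 1, so u = v lies in U ∩ V and is
-- orthogonal to itself.
variable (U V) in
theorem friedrichsCos_lt_one : friedrichsCos U V < 1 := by
  by_contra! h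
  obtain ⟨u, hu, v, hv, hu1, hv1, h1, -⟩ := exists_principal_vectors (U := U) (V := V) (by linarith)
  have hle : ‖V.starProjection u‖ ≤ 1 := hu1 ▸ V.norm_starProjection_apply_le u
  have hc : friedrichsCos U V = 1 := by
    refine le_antisymm ?_ h
    rwa [h1, norm_smul, hv1, mul_one, Real.norm_of_nonneg (by linarith)] at hle
  rw [hc, one_smul] at h1
  have huv : u = v := by
    have hi : inner ℝ u v = (1 : ℝ) := by
      have h2 := inner_starProjection_self V u
      rwa [h1, hv1, one_pow] at h2
    exact (inner_eq_one_iff_of_norm_eq_one hu1 hv1).1 hi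
  have h0 : inner ℝ u u = (0 : ℝ) := hu.2 u ⟨hu.1, huv ▸ hv.1⟩
  rw [real_inner_self_eq_norm_sq, hu1] at h0
  norm_num at h0

/-- If the Friedrichs angle is right, the composition of the projections is the projection onto
the intersection. -/
theorem starProjection_comp_of_friedrichsCos_eq_zero (hc : friedrichsCos U V = 0) (x : En n) :
    V.starProjection (U.starProjection x) = (U ⊓ V).starProjection x := by
  set W := U ⊓ V with hW
  have hWU : W.starProjection x ∈ U := (Submodule.starProjection_apply_mem W x).1
  have hWV : W.starProjection x ∈ V := (Submodule.starProjection_apply_mem W x).2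
  -- P_V vanishes on U ∩ Wᗮ when c = 0, so P_V P_U x = P_V P_W x = P_W x.
  have hmem : U.starProjection x - W.starProjection x ∈ U ⊓ W.orthogonal := by
    refine ⟨sub_mem (Submodule.starProjection_apply_mem _ _) hWU, fun w hw => ?_⟩
    rw [inner_sub_right, ← Submodule.inner_starProjection_left_eq_right,
      ← Submodule.inner_starProjection_left_eq_right, Submodule.starProjection_eq_self_iff.2 hw,
      Submodule.starProjection_eq_self_iff.2 hw.1, sub_self]
  have h := norm_starProjection_le_friedrichsCos_mul hmem
  rw [hc, zero_mul, norm_le_zero_iff, map_sub, sub_eq_zero,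
    Submodule.starProjection_eq_self_iff.2 hWV] at h
  exact h

/-- An eigenvalue of `P_U P_V` other than `1` with an eigenvector in `U` is at most `c_F²`. -/
theorem eigenvalue_le_friedrichsCos_sq {a : En n} (ha : a ∈ U) (ha0 : a ≠ 0) {κ : ℝ}
    (hκ : U.starProjection (V.starProjection a) = κ • a) (hκ1 : κ ≠ 1) :
    κ ≤ friedrichsCos U V ^ 2 := by
  have horth : a ∈ (U ⊓ V)ᗮ := by
    intro w hw
    have h : inner ℝ w (U.starProjection (V.starProjection a)) = (inner ℝ w a : ℝ) := by
      rw [← Submodule.inner_starProjection_left_eq_right,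
        Submodule.starProjection_eq_self_iff.2 hw.1,
        ← Submodule.inner_starProjection_left_eq_right,
        Submodule.starProjection_eq_self_iff.2 hw.2]
    rw [hκ, real_inner_smul_right] at h
    have h2 : (κ - 1) * inner ℝ w a = 0 := by linarith
    exact (mul_eq_zero.1 h2).resolve_left (sub_ne_zero.2 hκ1)
  have h := norm_starProjection_le_friedrichsCos_mul (V := V) ⟨ha, horth⟩
  have h2 : κ * ‖a‖ ^ 2 = ‖V.starProjection a‖ ^ 2 := by
    rw [← inner_starProjection_self, ← real_inner_self_eq_norm_sq, ← real_inner_smul_right, ← hκ,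
      ← Submodule.inner_starProjection_left_eq_right, Submodule.starProjection_eq_self_iff.2 ha]
  have h3 : 0 < ‖a‖ ^ 2 := by positivity
  have h4 : ‖V.starProjection a‖ ^ 2 ≤ (friedrichsCos U V * ‖a‖) ^ 2 := by gcongr
  rw [← h2, mul_pow] at h4
  exact le_of_mul_le_mul_right h4 h3

end Friedrichs

/-! ### Complexification -/

section Complexification

/-- The Euclidean space `ℂⁿ`. -/
abbrev Cn (n : ℕ) : Type := EuclideanSpace ℂ (Fin n)

variable {n : ℕ}

/-- The inclusion of `ℝⁿ` in `ℂⁿ`. -/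
def ofRealVec (a : En n) : Cn n := WithLp.toLp 2 fun i => (a i : ℂ)

/-- The vector of real parts. -/
def reVec (z : Cn n) : En n := WithLp.toLp 2 fun i => (z i).re

/-- The vector of imaginary parts. -/
def imVec (z : Cn n) : En n := WithLp.toLp 2 fun i => (z i).im

theorem ofRealVec_smul (t : ℝ) (a : En n) : ofRealVec (t • a) = (t : ℂ) • ofRealVec a := by
  ext i; simp [ofRealVec]

theorem norm_ofRealVec (a : En n) : ‖ofRealVec a‖ = ‖a‖ := by
  simp [EuclideanSpace.norm_eq, ofRealVec]

theorem ofRealVec_reVec_add_imVec (z : Cn n) :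
    ofRealVec (reVec z) + Complex.I • ofRealVec (imVec z) = z := by
  ext i
  simp [ofRealVec, reVec, imVec, mul_comm Complex.I, Complex.re_add_im]

theorem reVec_ofRealVec_add (a b : En n) : reVec (ofRealVec a + Complex.I • ofRealVec b) = a := by
  ext i; simp [ofRealVec, reVec]

theorem imVec_ofRealVec_add (a b : En n) : imVec (ofRealVec a + Complex.I • ofRealVec b) = b := by
  ext i; simp [ofRealVec, imVec]

theorem reVec_real_smul (t : ℝ) (z : Cn n) : reVec ((t : ℂ) • z) = t • reVec z := by
  ext i; simp [reVec]

theorem imVec_real_smul (t : ℝ) (z : Cn n) : imVec ((t : ℂ) • z) = t • imVec z := by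
  ext i; simp [imVec]

theorem eq_of_reVec_imVec {z w : Cn n} (h1 : reVec z = reVec w) (h2 : imVec z = imVec w) :
    z = w := by
  rw [← ofRealVec_reVec_add_imVec z, ← ofRealVec_reVec_add_imVec w, h1, h2]

/-- The complexification of the orthogonal projector onto a real subspace. -/
noncomputable def complexProj (U : Submodule ℝ (En n)) : Cn n →L[ℂ] Cn n :=
  Matrix.toEuclideanCLM (n := Fin n) (𝕜 := ℂ) ((projMatrix U).map Complex.ofReal)

theorem complexProj_ofRealVec (U : Submodule ℝ (En n)) (a : En n) :
    complexProj U (ofRealVec a) = ofRealVec (U.starProjection a) := by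
  have h : U.starProjection a = Matrix.toEuclideanCLM (n := Fin n) (𝕜 := ℝ) (projMatrix U) a := by
    simp [projMatrix]
  rw [h]
  ext i
  simp [complexProj, ofRealVec, Matrix.mulVec, dotProduct]

theorem complexProj_eq (U : Submodule ℝ (En n)) (z : Cn n) :
    complexProj U z = ofRealVec (U.starProjection (reVec z)) +
      Complex.I • ofRealVec (U.starProjection (imVec z)) := by
  conv_lhs => rw [← ofRealVec_reVec_add_imVec z]
  rw [map_add, map_smul, complexProj_ofRealVec, complexProj_ofRealVec]

theorem reVec_complexProj (U : Submodule ℝ (En n)) (z : Cn n) :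
    reVec (complexProj U z) = U.starProjection (reVec z) := by
  rw [complexProj_eq, reVec_ofRealVec_add]

theorem imVec_complexProj (U : Submodule ℝ (En n)) (z : Cn n) :
    imVec (complexProj U z) = U.starProjection (imVec z) := by
  rw [complexProj_eq, imVec_ofRealVec_add]

theorem complexProj_complexProj (U : Submodule ℝ (En n)) (z : Cn n) :
    complexProj U (complexProj U z) = complexProj U z := by
  apply eq_of_reVec_imVec <;>
  simp only [reVec_complexProj, imVec_complexProj] <;>
  exact Submodule.starProjection_eq_self_iff.2 (Submodule.starProjection_apply_mem _ _)

theorem isSelfAdjoint_complexProj (U : Submodule ℝ (En n)) : IsSelfAdjoint (complexProj U) := by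
  have h : star (projMatrix U) = projMatrix U := by
    apply EquivLike.injective (Matrix.toEuclideanCLM (n := Fin n) (𝕜 := ℝ))
    rw [map_star, projMatrix, StarAlgEquiv.apply_symm_apply,
      (isSelfAdjoint_starProjection U).star_eq]
  rw [IsSelfAdjoint, complexProj, ← map_star]
  congr 1
  ext i j
  have := congrFun (congrFun h i) j
  simp only [Matrix.star_apply, star_trivial] at this
  simp [Matrix.star_apply, this]

theorem inner_complexProj (U : Submodule ℝ (En n)) (x y : Cn n) :
    inner ℂ (complexProj U x) y = inner ℂ x (complexProj U y) :=
  (isSelfAdjoint_complexProj U).isSymmetric x y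

theorem inner_complexProj_self (U : Submodule ℝ (En n)) (x : Cn n) :
    inner ℂ x (complexProj U x) = ((‖complexProj U x‖ ^ 2 : ℝ) : ℂ) := by
  rw [← complexProj_complexProj, ← inner_complexProj, inner_self_eq_norm_sq_to_K]
  simp [complexProj_complexProj]

theorem complexProj_eq_zero_iff {U : Submodule ℝ (En n)} {z : Cn n} :
    complexProj U z = 0 ↔ reVec z ∈ Uᗮ ∧ imVec z ∈ Uᗮ := by
  rw [← Submodule.starProjection_apply_eq_zero_iff, ← Submodule.starProjection_apply_eq_zero_iff,
    ← reVec_complexProj, ← imVec_complexProj]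
  constructor
  · rintro h
    rw [h]
    constructor <;> ext i <;> simp [reVec, imVec]
  · rintro ⟨h1, h2⟩
    apply eq_of_reVec_imVec
    · rw [h1]; ext i; simp [reVec]
    · rw [h2]; ext i; simp [imVec]

theorem complexProj_eq_self_iff {U : Submodule ℝ (En n)} {z : Cn n} :
    complexProj U z = z ↔ reVec z ∈ U ∧ imVec z ∈ U := by
  rw [← Submodule.starProjection_eq_self_iff, ← Submodule.starProjection_eq_self_iff,
    ← reVec_complexProj, ← imVec_complexProj]
  constructor
  · intro h
    rw [h]
    exact ⟨rfl, rfl⟩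
  · rintro ⟨h1, h2⟩
    exact eq_of_reVec_imVec h1 h2

/-- `T_{α,β}` as an operator on `ℂⁿ`. -/
theorem toEuclideanCLM_aamr (U V : Submodule ℝ (En n)) (α β : ℝ) :
    Matrix.toEuclideanCLM (n := Fin n) (𝕜 := ℂ) (aamr U V α β) =
      (1 - α : ℂ) • (1 : Cn n →L[ℂ] Cn n) +
        (α : ℂ) • (((2 * β : ℂ) • complexProj V - 1) * ((2 * β : ℂ) • complexProj U - 1)) := by
  have h : aamr U V α β = (1 - α : ℂ) • (1 : Matrix (Fin n) (Fin n) ℂ) +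
      (α : ℂ) • (((2 * β : ℂ) • (projMatrix V).map Complex.ofReal - 1) *
        ((2 * β : ℂ) • (projMatrix U).map Complex.ofReal - 1)) := by
    have hs : ∀ (t : ℝ) (A : Matrix (Fin n) (Fin n) ℝ),
        (t • A).map Complex.ofRealHom = (t : ℂ) • A.map Complex.ofRealHom := by
      intro t A; ext i j; simp
    change (aamrReal U V α β).map Complex.ofRealHom = (1 - α : ℂ) • (1 : Matrix (Fin n) (Fin n) ℂ) +
      (α : ℂ) • (((2 * β : ℂ) • (projMatrix V).map Complex.ofRealHom - 1) *
        ((2 * β : ℂ) • (projMatrix U).map Complex.ofRealHom - 1))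
    rw [aamrReal, Matrix.map_add _ (map_add _), hs, hs, Matrix.map_mul,
      Matrix.map_sub _ (map_sub _), Matrix.map_sub _ (map_sub _), hs, hs,
      Matrix.map_one _ (map_zero _) (map_one _)]
    push_cast
    rfl
  rw [h]
  simp only [map_add, map_sub, map_mul, map_smul, map_one]
  rfl

theorem toEuclideanCLM_aamr_apply (U V : Submodule ℝ (En n)) (α β : ℝ) (x : Cn n) :
    Matrix.toEuclideanCLM (n := Fin n) (𝕜 := ℂ) (aamr U V α β) x =
      (1 - α : ℂ) • x + (α : ℂ) • ((2 * β : ℂ) •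
        complexProj V ((2 * β : ℂ) • complexProj U x - x) -
          ((2 * β : ℂ) • complexProj U x - x)) := by
  rw [toEuclideanCLM_aamr]
  rfl

end Complexification

/-! ### Linear convergence rates of matrices -/

section Rates

variable {n : ℕ}

theorem mem_spectrum_iff_exists_eigenvector {A : Matrix (Fin n) (Fin n) ℂ} {z : ℂ} :
    z ∈ spectrum ℂ A ↔
      ∃ x : Cn n, x ≠ 0 ∧ Matrix.toEuclideanCLM (n := Fin n) (𝕜 := ℂ) A x = z • x := by
  rw [← Matrix.spectrum_toLpLin 2, ← Module.End.hasEigenvalue_iff_mem_spectrum]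
  constructor
  · intro h
    obtain ⟨x, hx⟩ := h.exists_hasEigenvector
    exact ⟨x, hx.2, hx.apply_eq_smul⟩
  · rintro ⟨x, hx0, hx⟩
    exact Module.End.hasEigenvalue_of_hasEigenvector
      (x := x) ⟨Module.End.mem_eigenspace_iff.2 hx, hx0⟩

theorem finite_subdominant_set (A : Matrix (Fin n) (Fin n) ℂ) :
    ((fun z : ℂ => ‖z‖) '' ({0} ∪ (spectrum ℂ A \ {1}))).Finite :=
  ((Set.finite_singleton _).union ((Matrix.finite_spectrum A).subset Set.sdiff_subset)).image _

theorem norm_le_subdominant {A : Matrix (Fin n) (Fin n) ℂ} {z : ℂ} (hz : z ∈ spectrum ℂ A)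
    (hz1 : z ≠ 1) : ‖z‖ ≤ subdominant A :=
  le_csSup (finite_subdominant_set A).bddAbove ⟨z, Or.inr ⟨hz, hz1⟩, rfl⟩

theorem subdominant_nonneg (A : Matrix (Fin n) (Fin n) ℂ) : 0 ≤ subdominant A :=
  le_csSup (finite_subdominant_set A).bddAbove ⟨0, Or.inl rfl, norm_zero⟩

theorem subdominant_mem (A : Matrix (Fin n) (Fin n) ℂ) :
    subdominant A ∈ (fun z : ℂ => ‖z‖) '' ({0} ∪ (spectrum ℂ A \ {1})) :=
  Set.Nonempty.csSup_mem ⟨_, 0, Or.inl rfl, rfl⟩ (finite_subdominant_set A)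

theorem subdominant_le {A : Matrix (Fin n) (Fin n) ℂ} {r : ℝ} (hr : 0 ≤ r)
    (h : ∀ z ∈ spectrum ℂ A, z ≠ 1 → ‖z‖ ≤ r) : subdominant A ≤ r := by
  obtain ⟨z, hz, hzr⟩ := subdominant_mem A
  rw [← hzr]
  rcases hz with rfl | ⟨hz, hz1⟩
  · simpa using hr
  · exact h z hz hz1

theorem norm_pow_sub_apply_le (A B : Matrix (Fin n) (Fin n) ℂ) (k : ℕ) (x : Cn n) :
    ‖((Matrix.toEuclideanCLM (n := Fin n) (𝕜 := ℂ) A) ^ k) x -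
      Matrix.toEuclideanCLM (n := Fin n) (𝕜 := ℂ) B x‖ ≤ inducedNorm (A ^ k - B) * ‖x‖ := by
  have h := (Matrix.toEuclideanCLM (n := Fin n) (𝕜 := ℂ) (A ^ k - B)).le_opNorm x
  rw [map_sub, map_pow] at h
  simpa [inducedNorm] using h

/-- Every eigenvalue other than `1` is bounded by every linear convergence rate. -/
theorem norm_le_of_mem_linearRates {A : Matrix (Fin n) (Fin n) ℂ} {μ : ℝ} (hμ : μ ∈ linearRates A)
    {z : ℂ} (hz : z ∈ spectrum ℂ A) (hz1 : z ≠ 1) : ‖z‖ ≤ μ := by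
  obtain ⟨B, hμ0, hμ1, k₀, hk₀, M, hM, hB⟩ := hμ
  obtain ⟨x, hx0, hx⟩ := mem_spectrum_iff_exists_eigenvector.1 hz
  have hpow : ∀ k : ℕ, ((Matrix.toEuclideanCLM (n := Fin n) (𝕜 := ℂ) A) ^ k) x = z ^ k • x := by
    intro k
    induction k with
    | zero => simp
    | succ k ih =>
      rw [pow_succ, mul_apply_eq_comp, hx, map_smul, ih, smul_smul, pow_succ, mul_comm]
  set y := Matrix.toEuclideanCLM (n := Fin n) (𝕜 := ℂ) B x with hy
  have hbound : ∀ k, k₀ ≤ k → ‖z ^ k • x - y‖ ≤ M * μ ^ k * ‖x‖ := by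
    intro k hk
    rw [← hpow]
    exact (norm_pow_sub_apply_le A B k x).trans (by gcongr; exact hB k hk)
  have hlim0 : Filter.Tendsto (fun k : ℕ => M * μ ^ k * ‖x‖) Filter.atTop (nhds 0) := by
    simpa using ((tendsto_pow_atTop_nhds_zero_of_lt_one hμ0 hμ1).const_mul M).mul_const ‖x‖
  have hlim : Filter.Tendsto (fun k : ℕ => z ^ k • x) Filter.atTop (nhds y) := by
    rw [tendsto_iff_norm_sub_tendsto_zero]
    exact squeeze_zero' (Filter.Eventually.of_forall fun _ => norm_nonneg _)
      (Filter.eventually_atTop.2 ⟨k₀, hbound⟩) hlim0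
  -- The shifted sequence has the same limit, so y = z y with z ≠ 1.
  have hy0 : y = 0 := by
    have h1 : Filter.Tendsto (fun k : ℕ => z ^ (k + 1) • x) Filter.atTop (nhds y) :=
      hlim.comp (Filter.tendsto_add_atTop_nat 1)
    have h2 : Filter.Tendsto (fun k : ℕ => z ^ (k + 1) • x) Filter.atTop (nhds (z • y)) := by
      have := hlim.const_smul z
      simpa [smul_smul, pow_succ'] using this
    have h3 : (z - 1) • y = 0 := by
      rw [sub_smul, one_smul, tendsto_nhds_unique h2 h1, sub_self]
    exact (smul_eq_zero.1 h3).resolve_left (sub_ne_zero.2 hz1)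
  have hxn : 0 < ‖x‖ := norm_pos_iff.2 hx0
  have hk : ∀ k, k₀ ≤ k → ‖z‖ ^ k ≤ M * μ ^ k := by
    intro k hk
    have h := hbound k hk
    rw [hy0, sub_zero, norm_smul, norm_pow] at h
    exact le_of_mul_le_mul_right h hxn
  by_contra! hlt
  have hzpos : 0 < ‖z‖ := hμ0.trans_lt hlt
  have hq : Filter.Tendsto (fun k : ℕ => M * (μ / ‖z‖) ^ k) Filter.atTop (nhds 0) := by
    simpa using (tendsto_pow_atTop_nhds_zero_of_lt_one (by positivity)
      ((div_lt_one hzpos).2 hlt)).const_mul M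
  obtain ⟨k, hk1, hk2⟩ := ((hq.eventually (gt_mem_nhds one_pos)).and
    (Filter.eventually_ge_atTop k₀)).exists
  have h := hk k hk2
  rw [div_pow, mul_div_assoc', div_lt_one (by positivity)] at hk1
  linarith

/-- A Jordan block of size at least two for a nonzero eigenvalue `ρ` forces rates beyond `|ρ|`. -/
theorem notMem_linearRates_of_jordan {A : Matrix (Fin n) (Fin n) ℂ} {ρ : ℝ} (hρ : 0 < ρ)
    {e f : Cn n} (he0 : e ≠ 0)
    (he : Matrix.toEuclideanCLM (n := Fin n) (𝕜 := ℂ) A e = (ρ : ℂ) • e)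
    (hf : Matrix.toEuclideanCLM (n := Fin n) (𝕜 := ℂ) A f = (ρ : ℂ) • f + e) :
    ρ ∉ linearRates A := by
  rintro ⟨B, -, hρ1, k₀, hk₀, M, hM, hB⟩
  -- The coefficient k ρ^(k-1) is written as k ρ^k / ρ, avoiding a truncated exponent at k = 0.
  have hpow : ∀ k : ℕ, ((Matrix.toEuclideanCLM (n := Fin n) (𝕜 := ℂ) A) ^ k) f =
      ((ρ ^ k : ℝ) : ℂ) • f + ((k * ρ ^ k / ρ : ℝ) : ℂ) • e := by
    intro k
    induction k with
    | zero => simp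
    | succ k ih =>
      rw [pow_succ', mul_apply_eq_comp, ih, map_add, map_smul, map_smul, he, hf]
      have : (ρ : ℂ) ≠ 0 := by exact_mod_cast hρ.ne'
      rw [smul_add, smul_smul, smul_smul, add_assoc, ← add_smul]
      congr 2
      · push_cast; ring
      · push_cast; field_simp; ring
  set y := Matrix.toEuclideanCLM (n := Fin n) (𝕜 := ℂ) B f with hy
  have hbound : ∀ k, k₀ ≤ k → ‖((ρ ^ k : ℝ) : ℂ) • f + ((k * ρ ^ k / ρ : ℝ) : ℂ) • e - y‖ ≤
      M * ρ ^ k * ‖f‖ := by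
    intro k hk
    rw [← hpow]
    exact (norm_pow_sub_apply_le A B k f).trans (by gcongr; exact hB k hk)
  have hρk := tendsto_pow_atTop_nhds_zero_of_lt_one hρ.le hρ1
  have hlim0 : Filter.Tendsto (fun k : ℕ => M * ρ ^ k * ‖f‖) Filter.atTop (nhds 0) := by
    simpa using (hρk.const_mul M).mul_const ‖f‖
  have hlim1 : Filter.Tendsto
      (fun k : ℕ => ((ρ ^ k : ℝ) : ℂ) • f + ((k * ρ ^ k / ρ : ℝ) : ℂ) • e)
      Filter.atTop (nhds 0) := by
    have h1 := (Complex.continuous_ofReal.tendsto 0).comp hρk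
    have h2 := (tendsto_self_mul_const_pow_of_lt_one hρ.le hρ1).div_const ρ
    rw [zero_div] at h2
    have h3 := (Complex.continuous_ofReal.tendsto 0).comp h2
    simpa using (h1.smul_const f).add (h3.smul_const e)
  have hy0 : y = 0 := by
    refine tendsto_nhds_unique ?_ hlim1
    rw [tendsto_iff_norm_sub_tendsto_zero]
    exact squeeze_zero' (Filter.Eventually.of_forall fun _ => norm_nonneg _)
      (Filter.eventually_atTop.2 ⟨k₀, hbound⟩) hlim0
  have hen : 0 < ‖e‖ := norm_pos_iff.2 he0
  -- Dividing the rate bound by ρ^k leaves a linear function of k bounded by a constant.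
  have hk : ∀ k : ℕ, k₀ ≤ k → (k : ℝ) * ‖e‖ ≤ (M + 1) * ‖f‖ * ρ := by
    intro k hk
    have h := hbound k hk
    rw [hy0, sub_zero] at h
    have h1 := norm_sub_le (((ρ ^ k : ℝ) : ℂ) • f + ((k * ρ ^ k / ρ : ℝ) : ℂ) • e)
      (((ρ ^ k : ℝ) : ℂ) • f)
    rw [add_sub_cancel_left, norm_smul, norm_smul (((ρ ^ k : ℝ) : ℂ)), Complex.norm_real,
      Complex.norm_real, Real.norm_of_nonneg (by positivity),
      Real.norm_of_nonneg (by positivity)] at h1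
    have h2 : k * ρ ^ k / ρ * ‖e‖ ≤ (M + 1) * ‖f‖ * ρ ^ k := by linarith
    have h3 : 0 < ρ ^ k := by positivity
    rw [div_mul_eq_mul_div, div_le_iff₀ hρ] at h2
    refine le_of_mul_le_mul_right ?_ h3
    linarith
  obtain ⟨k, hk1, hk2⟩ := ((tendsto_natCast_atTop_atTop.eventually_gt_atTop
    ((M + 1) * ‖f‖ * ρ / ‖e‖)).and (Filter.eventually_ge_atTop k₀)).exists
  rw [div_lt_iff₀ hen] at hk1
  exact absurd (hk k hk2) (not_le.2 hk1)

/-- If `B` is a projector commuting with `A` onto the fixed points of `A`, every number strictly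
between `γ(A)` and `1` is a linear convergence rate. -/
theorem mem_linearRates_of_subdominant_lt {A B : Matrix (Fin n) (Fin n) ℂ} (hAB : A * B = B)
    (hBA : B * A = B) (hBB : B * B = B)
    (hfix : ∀ x : Cn n, Matrix.toEuclideanCLM (n := Fin n) (𝕜 := ℂ) A x = x →
      Matrix.toEuclideanCLM (n := Fin n) (𝕜 := ℂ) B x = x)
    {μ : ℝ} (hμ : subdominant A < μ) (hμ1 : μ < 1) : μ ∈ linearRates A := by
  have hμ0 : 0 < μ := (subdominant_nonneg A).trans_lt hμ
  set a := Matrix.toEuclideanCLM (n := Fin n) (𝕜 := ℂ) (A - B) with ha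
  -- The exponent starts at 1: at exponent 0 the two sides are I and I - B.
  have hpow : ∀ k : ℕ, (A - B) ^ (k + 1) = A ^ (k + 1) - B := by
    intro k
    induction k with
    | zero => simp
    | succ k ih =>
      have hAk : A ^ (k + 1) * B = B := by
        clear ih
        induction k with
        | zero => simpa using hAB
        | succ k ih => rw [pow_succ, mul_assoc, hAB, ih]
      rw [pow_succ, ih, sub_mul, mul_sub, mul_sub, hAk, hBA, hBB, ← pow_succ]
      simp
  have hspec : ∀ z ∈ spectrum ℂ a, ‖z‖ ≤ subdominant A := by
    intro z hz
    rw [ha, AlgEquiv.spectrum_eq, mem_spectrum_iff_exists_eigenvector] at hz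
    obtain ⟨x, hx0, hx⟩ := hz
    rcases eq_or_ne z 0 with rfl | hz0
    · simpa using subdominant_nonneg A
    -- B(A - B) = 0, so B kills eigenvectors of A - B for z ≠ 0; these are then eigenvectors of A,
    -- and `hfix` excludes z = 1.
    have hBx : Matrix.toEuclideanCLM (n := Fin n) (𝕜 := ℂ) B x = 0 := by
      have h : Matrix.toEuclideanCLM (n := Fin n) (𝕜 := ℂ) (B * (A - B)) x = 0 := by
        rw [mul_sub, hBA, hBB, sub_self, map_zero]; rfl
      rw [map_mul, mul_apply_eq_comp, hx, map_smul] at h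
      exact (smul_eq_zero.1 h).resolve_left hz0
    have hAx : Matrix.toEuclideanCLM (n := Fin n) (𝕜 := ℂ) A x = z • x := by
      rw [← hx, map_sub, sub_apply, hBx, sub_zero]
    refine norm_le_subdominant (mem_spectrum_iff_exists_eigenvector.2 ⟨x, hx0, hAx⟩) ?_
    rintro rfl
    rw [one_smul] at hAx
    exact hx0 (by rw [← hfix x hAx, hBx])
  have hrad : spectralRadius ℂ a < ENNReal.ofReal μ := by
    refine lt_of_le_of_lt ?_ ((ENNReal.ofReal_lt_ofReal_iff hμ0).2 hμ)
    refine iSup₂_le fun z hz => ?_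
    rw [← enorm_eq_nnnorm, ← ofReal_norm]
    exact ENNReal.ofReal_le_ofReal (hspec z hz)
  -- Gelfand's formula: eventually ‖a^k‖^(1/k) < μ.
  have hev := (spectrum.pow_norm_pow_one_div_tendsto_nhds_spectralRadius a).eventually
    (gt_mem_nhds hrad)
  obtain ⟨N, hN⟩ := Filter.eventually_atTop.1 hev
  refine ⟨B, hμ0.le, hμ1, N + 1, N.succ_pos, 1, one_pos, fun k hk => ?_⟩
  have h := (hN k (by omega)).le
  obtain ⟨j, rfl⟩ : ∃ j, k = j + 1 := ⟨k - 1, by omega⟩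
  rw [ENNReal.ofReal_le_ofReal_iff hμ0.le, one_div,
    Real.rpow_inv_le_iff_of_pos (norm_nonneg _) hμ0.le (by positivity), Real.rpow_natCast] at h
  rw [inducedNorm, ← hpow, map_pow, one_mul]
  exact h

theorem isGLB_linearRates {A B : Matrix (Fin n) (Fin n) ℂ} (hAB : A * B = B)
    (hBA : B * A = B) (hBB : B * B = B)
    (hfix : ∀ x : Cn n, Matrix.toEuclideanCLM (n := Fin n) (𝕜 := ℂ) A x = x →
      Matrix.toEuclideanCLM (n := Fin n) (𝕜 := ℂ) B x = x)
    (h1 : subdominant A < 1) : IsGLB (linearRates A) (subdominant A) := by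
  constructor
  · intro μ hμ
    refine subdominant_le ?_ fun z hz hz1 => norm_le_of_mem_linearRates hμ hz hz1
    obtain ⟨B, h, -⟩ := hμ
    exact h
  · intro b hb
    refine le_of_forall_gt_imp_ge_of_dense fun μ hμ => ?_
    -- A rate must be below 1, so μ is capped by a number between γ(A) and 1.
    refine (hb (a := min μ ((subdominant A + 1) / 2)) ?_).trans (min_le_left _ _)
    exact mem_linearRates_of_subdominant_lt hAB hBA hBB hfix (lt_min hμ (by linarith))
      ((min_le_right _ _).trans_lt (by linarith))

end Rates

/-! ### Spectrum of the averaged alternating modified reflections operator -/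

section Aamr

variable {n : ℕ} {U V : Submodule ℝ (En n)}

/-! ### Contraction off the fixed space, and the infimum of the rates -/

/-- Expand the square using ⟨Px, x⟩ = ‖Px‖². For 0 < β < 1 the factor 4β(1 - β) is positive, the
source of all strict contraction below. -/
theorem norm_sq_modifiedReflection (U : Submodule ℝ (En n)) (β : ℝ) (x : Cn n) :
    ‖(2 * β : ℂ) • complexProj U x - x‖ ^ 2 =
      ‖x‖ ^ 2 - 4 * β * (1 - β) * ‖complexProj U x‖ ^ 2 := by
  have hi : inner ℂ ((2 * β : ℂ) • complexProj U x) x =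
      ((2 * β * ‖complexProj U x‖ ^ 2 : ℝ) : ℂ) := by
    rw [show (2 * β : ℂ) = ((2 * β : ℝ) : ℂ) by push_cast; rfl, inner_smul_left,
      inner_complexProj, inner_complexProj_self, Complex.conj_ofReal, ← Complex.ofReal_mul]
  have hn : ‖(2 * β : ℂ) • complexProj U x‖ ^ 2 = (2 * β) ^ 2 * ‖complexProj U x‖ ^ 2 := by
    rw [norm_smul, mul_pow]
    congr 1
    rw [show (2 * β : ℂ) = ((2 * β : ℝ) : ℂ) by push_cast; rfl, Complex.norm_real, Real.norm_eq_abs,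
      sq_abs]
  rw [norm_sub_sq (𝕜 := ℂ), hi, hn]
  simp only [RCLike.re_eq_complex_re, Complex.ofReal_re]
  ring

/-- The composition of two modified reflections strictly decreases the norm off the intersection of
the orthogonal complements. -/
theorem norm_reflections_lt {β : ℝ} (hβ : β ∈ Set.Ioo (0 : ℝ) 1) (x : Cn n) :
    ‖(2 * β : ℂ) • complexProj V ((2 * β : ℂ) • complexProj U x - x) -
      ((2 * β : ℂ) • complexProj U x - x)‖ < ‖x‖ ∨ (complexProj U x = 0 ∧ complexProj V x = 0) := by
  have hpos : 0 < 4 * β * (1 - β) := by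
    have := hβ.1
    have := sub_pos.2 hβ.2
    positivity
  have h1 := norm_sq_modifiedReflection U β x
  have h2 := norm_sq_modifiedReflection V β ((2 * β : ℂ) • complexProj U x - x)
  by_cases hU : complexProj U x = 0
  · by_cases hV : complexProj V x = 0
    · exact Or.inr ⟨hU, hV⟩
    · left
      rw [hU, smul_zero, zero_sub] at h2 ⊢
      have : 0 < ‖complexProj V x‖ := norm_pos_iff.2 hV
      have : 0 < 4 * β * (1 - β) * ‖complexProj V x‖ ^ 2 := by positivity
      rw [map_neg, norm_neg, norm_neg] at h2
      refine lt_of_pow_lt_pow_left₀ 2 (norm_nonneg _) ?_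
      rw [map_neg]
      linarith
  · left
    have : 0 < ‖complexProj U x‖ := norm_pos_iff.2 hU
    have : 0 < 4 * β * (1 - β) * ‖complexProj U x‖ ^ 2 := by positivity
    have : 0 ≤ 4 * β * (1 - β) *
      ‖complexProj V ((2 * β : ℂ) • complexProj U x - x)‖ ^ 2 := by positivity
    refine lt_of_pow_lt_pow_left₀ 2 (norm_nonneg _) ?_
    linarith

theorem aamr_apply_of_complexProj_eq_zero (α β : ℝ) {x : Cn n} (hU : complexProj U x = 0)
    (hV : complexProj V x = 0) :
    Matrix.toEuclideanCLM (n := Fin n) (𝕜 := ℂ) (aamr U V α β) x = x := by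
  rw [toEuclideanCLM_aamr_apply, hU, smul_zero, zero_sub, map_neg, hV]
  module

theorem norm_aamr_apply_lt {α β : ℝ} (hα : α ∈ Set.Ioc (0 : ℝ) 1) (hβ : β ∈ Set.Ioo (0 : ℝ) 1)
    (x : Cn n) : ‖Matrix.toEuclideanCLM (n := Fin n) (𝕜 := ℂ) (aamr U V α β) x‖ < ‖x‖ ∨
      (complexProj U x = 0 ∧ complexProj V x = 0) := by
  refine (norm_reflections_lt (U := U) (V := V) hβ x).imp_left fun h => ?_
  rw [toEuclideanCLM_aamr_apply]
  refine (norm_add_le _ _).trans_lt ?_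
  rw [norm_smul, norm_smul, show (1 - α : ℂ) = ((1 - α : ℝ) : ℂ) by push_cast; rfl,
    Complex.norm_real, Complex.norm_real, Real.norm_of_nonneg (sub_nonneg.2 hα.2),
    Real.norm_of_nonneg hα.1.le]
  have := mul_lt_mul_of_pos_left h hα.1
  linarith

/-- An eigenvector that is not strictly shrunk lies in the space where T is the identity, so its
eigenvalue is 1. -/
theorem norm_lt_one_of_mem_spectrum_aamr {α β : ℝ} (hα : α ∈ Set.Ioc (0 : ℝ) 1)
    (hβ : β ∈ Set.Ioo (0 : ℝ) 1) {z : ℂ} (hz : z ∈ spectrum ℂ (aamr U V α β)) (hz1 : z ≠ 1) :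
    ‖z‖ < 1 := by
  obtain ⟨x, hx0, hx⟩ := mem_spectrum_iff_exists_eigenvector.1 hz
  rcases norm_aamr_apply_lt (U := U) (V := V) hα hβ x with h | ⟨hU, hV⟩
  · rw [hx, norm_smul] at h
    have : 0 < ‖x‖ := norm_pos_iff.2 hx0
    by_contra! h'
    nlinarith
  · rw [aamr_apply_of_complexProj_eq_zero α β hU hV] at hx
    have h : (z - 1) • x = 0 := by rw [sub_smul, ← hx, one_smul, sub_self]
    exact absurd (sub_eq_zero.1 ((smul_eq_zero.1 h).resolve_right hx0)) hz1

theorem subdominant_aamr_lt_one {α β : ℝ} (hα : α ∈ Set.Ioc (0 : ℝ) 1)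
    (hβ : β ∈ Set.Ioo (0 : ℝ) 1) : subdominant (aamr U V α β) < 1 := by
  obtain ⟨z, hz, hzr⟩ := subdominant_mem (aamr U V α β)
  rw [← hzr]
  rcases hz with rfl | ⟨hz, hz1⟩
  · simp
  · exact norm_lt_one_of_mem_spectrum_aamr hα hβ hz hz1

theorem complexProj_complexProj_eq_zero {U W : Submodule ℝ (En n)} (h : W ≤ Uᗮ) (x : Cn n) :
    complexProj U (complexProj W x) = 0 := by
  rw [complexProj_eq_zero_iff, reVec_complexProj, imVec_complexProj]
  exact ⟨h (Submodule.starProjection_apply_mem _ _), h (Submodule.starProjection_apply_mem _ _)⟩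

/-- The infimum of the linear convergence rates of `T_{α,β}` is `γ(T_{α,β})`. -/
theorem isGLB_linearRates_aamr {α β : ℝ} (hα : α ∈ Set.Ioc (0 : ℝ) 1)
    (hβ : β ∈ Set.Ioo (0 : ℝ) 1) :
    IsGLB (linearRates (aamr U V α β)) (subdominant (aamr U V α β)) := by
  have hWU : Uᗮ ⊓ Vᗮ ≤ Uᗮ := inf_le_left
  have hWV : Uᗮ ⊓ Vᗮ ≤ Vᗮ := inf_le_right
  have hUW : U ≤ (Uᗮ ⊓ Vᗮ)ᗮ := (Submodule.le_orthogonal_orthogonal U).trans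
    (Submodule.orthogonal_le hWU)
  have hVW : V ≤ (Uᗮ ⊓ Vᗮ)ᗮ := (Submodule.le_orthogonal_orthogonal V).trans
    (Submodule.orthogonal_le hWV)
  have hB : Matrix.toEuclideanCLM (n := Fin n) (𝕜 := ℂ)
      ((projMatrix (Uᗮ ⊓ Vᗮ)).map Complex.ofReal) = complexProj (Uᗮ ⊓ Vᗮ) := rfl
  have hinj := EquivLike.injective (Matrix.toEuclideanCLM (n := Fin n) (𝕜 := ℂ))
  refine isGLB_linearRates (B := (projMatrix (Uᗮ ⊓ Vᗮ)).map Complex.ofReal) ?_ ?_ ?_ ?_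
    (subdominant_aamr_lt_one hα hβ)
  · apply hinj
    rw [map_mul, hB]
    refine ContinuousLinearMap.ext fun x => ?_
    rw [mul_apply_eq_comp]
    exact aamr_apply_of_complexProj_eq_zero α β (complexProj_complexProj_eq_zero hWU x)
      (complexProj_complexProj_eq_zero hWV x)
  -- U and V are orthogonal to Uᗮ ∩ Vᗮ, so B annihilates every term of T x containing a projector.
  · apply hinj
    rw [map_mul, hB]
    refine ContinuousLinearMap.ext fun x => ?_
    rw [mul_apply_eq_comp, toEuclideanCLM_aamr_apply]
    simp only [map_add, map_sub, map_smul, complexProj_complexProj_eq_zero hUW,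
      complexProj_complexProj_eq_zero hVW]
    module
  · apply hinj
    rw [map_mul, hB]
    refine ContinuousLinearMap.ext fun x => ?_
    rw [mul_apply_eq_comp, complexProj_complexProj]
  · intro x hx
    rw [hB, complexProj_eq_self_iff]
    rcases norm_aamr_apply_lt (U := U) (V := V) hα hβ x with h | ⟨hU, hV⟩
    · rw [hx] at h
      exact absurd h (lt_irrefl _)
    · rw [complexProj_eq_zero_iff] at hU hV
      exact ⟨⟨hU.1, hV.1⟩, ⟨hU.2, hV.2⟩⟩

/-! ### Eigenvalues on the principal plane and the lower bound -/

/-- Action of `T_{α,β}` on the first of two principal vectors. -/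
theorem aamr_apply_fst {u v : Cn n} {c : ℝ} (hu : complexProj U u = u)
    (huv : complexProj V u = (c : ℂ) • v) (α β : ℝ) :
    Matrix.toEuclideanCLM (n := Fin n) (𝕜 := ℂ) (aamr U V α β) u =
      (1 - α - α * (2 * β - 1) : ℂ) • u + (α * (2 * β - 1) * (2 * β * c) : ℂ) • v := by
  rw [toEuclideanCLM_aamr_apply]
  simp only [map_sub, map_smul, hu, huv]
  module

/-- Action of `T_{α,β}` on the second of two principal vectors. -/
theorem aamr_apply_snd {u v : Cn n} {c : ℝ} (hv : complexProj V v = v)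
    (huv : complexProj V u = (c : ℂ) • v) (hvu : complexProj U v = (c : ℂ) • u) (α β : ℝ) :
    Matrix.toEuclideanCLM (n := Fin n) (𝕜 := ℂ) (aamr U V α β) v =
      (-(α * (2 * β * c)) : ℂ) • u + (1 - α + α * (4 * β ^ 2 * c ^ 2 - (2 * β - 1)) : ℂ) • v := by
  rw [toEuclideanCLM_aamr_apply]
  simp only [map_sub, map_smul, hv, huv, hvu]
  module

/-- The complexified principal vectors. -/
theorem exists_complex_principal_vectors (hc : 0 < friedrichsCos U V) :
    ∃ u v : Cn n, ‖u‖ = 1 ∧ ‖v‖ = 1 ∧ complexProj U u = u ∧ complexProj V v = v ∧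
      complexProj V u = (friedrichsCos U V : ℂ) • v ∧
      complexProj U v = (friedrichsCos U V : ℂ) • u := by
  obtain ⟨u, hu, v, hv, hu1, hv1, huv, hvu⟩ := exists_principal_vectors hc
  refine ⟨ofRealVec u, ofRealVec v, ?_, ?_, ?_, ?_, ?_, ?_⟩
  · rw [norm_ofRealVec, hu1]
  · rw [norm_ofRealVec, hv1]
  · rw [complexProj_ofRealVec, Submodule.starProjection_eq_self_iff.2 hu.1]
  · rw [complexProj_ofRealVec, Submodule.starProjection_eq_self_iff.2 hv.1]
  · rw [complexProj_ofRealVec, huv, ofRealVec_smul]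
  · rw [complexProj_ofRealVec, hvu, ofRealVec_smul]

/-- The principal vectors for the Friedrichs angle yield the eigenvalues `1 - α + α λ` of
`T_{α,β}` with `λ = (β c_F + w)²` and `w² = β² c_F² - 2 β + 1`. -/
theorem mem_spectrum_aamr (hc : 0 < friedrichsCos U V) {α β : ℝ} (hβ : 0 < β) {w : ℂ}
    (hw : w ^ 2 = (β ^ 2 * friedrichsCos U V ^ 2 - 2 * β + 1 : ℝ)) :
    (1 - α + α * (β * friedrichsCos U V + w) ^ 2 : ℂ) ∈ spectrum ℂ (aamr U V α β) := by
  obtain ⟨u, v, hu1, hv1, hu, hv, huv, hvu⟩ := exists_complex_principal_vectors hc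
  have hc1 := friedrichsCos_lt_one U V
  set c := friedrichsCos U V
  push_cast at hw
  -- With λ = (βc + w)², the vector a u - b v satisfies the u-coordinate of the eigenvalue equation
  -- when a = 2βc and b = 2β - 1 + λ.
  refine mem_spectrum_iff_exists_eigenvector.2
    ⟨(2 * β * c : ℂ) • u - ((2 * β - 1) + (β * c + w) ^ 2 : ℂ) • v, ?_, ?_⟩
  · intro h
    set b := ((2 * β - 1) + (β * c + w) ^ 2 : ℂ)
    have hv0 : v ≠ 0 := by rintro rfl; simp at hv1
    have hu0 : u ≠ 0 := by rintro rfl; simp at hu1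
    have hV := congrArg (complexProj V) h
    have hU := congrArg (complexProj U) h
    rw [map_sub, map_smul, map_smul, huv, hv, map_zero, smul_smul, ← sub_smul] at hV
    rw [map_sub, map_smul, map_smul, hvu, hu, map_zero, smul_smul, ← sub_smul] at hU
    have hV' := (smul_eq_zero.1 hV).resolve_right hv0
    have hU' := (smul_eq_zero.1 hU).resolve_right hu0
    -- The projections of a u - b v = 0 give a = bc and ac = b; eliminating b gives a(1 - c²) = 0.
    have h3 : (2 * β * c * (1 - c ^ 2) : ℂ) = 0 := by linear_combination hU' - c * hV'
    have h4 : 2 * β * c * (1 - c ^ 2) = 0 := by exact_mod_cast h3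
    have : 0 < 1 - c ^ 2 := by nlinarith
    have : 0 < 2 * β * c * (1 - c ^ 2) := by positivity
    linarith
  · rw [map_sub, map_smul, map_smul, aamr_apply_fst hu huv, aamr_apply_snd hv huv hvu]
    have e1 : (2 * β * c : ℂ) * (1 - α - α * (2 * β - 1)) -
        ((2 * β - 1) + (β * c + w) ^ 2) * (-(α * (2 * β * c))) =
        (1 - α + α * (β * c + w) ^ 2) * (2 * β * c) := by ring
    have e2 : (2 * β * c : ℂ) * (α * (2 * β - 1) * (2 * β * c)) -
        ((2 * β - 1) + (β * c + w) ^ 2) * (1 - α + α * (4 * β ^ 2 * c ^ 2 - (2 * β - 1))) =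
        -((1 - α + α * (β * c + w) ^ 2) * ((2 * β - 1) + (β * c + w) ^ 2)) := by
      have hβ' : (2 * β - 1 : ℂ) = β ^ 2 * c ^ 2 - w ^ 2 := by rw [hw]; ring
      rw [hβ']
      ring
    have h3 : ∀ a b p q r s : ℂ, a • (p • u + q • v) - b • (r • u + s • v) =
        (a * p - b * r) • u + (a * q - b * s) • v := by
      intros; module
    rw [h3, e1, e2]
    module

/-- The eigenvalues from the Friedrichs angle differ from `1`. -/
theorem friedrichs_eigenvalue_ne_one {α β c : ℝ} (hα : α ≠ 0) (hβ : 0 < β) (hc : 0 ≤ c)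
    (hc1 : c < 1) {w : ℂ} (hw : w ^ 2 = (β ^ 2 * c ^ 2 - 2 * β + 1 : ℝ)) :
    (1 - α + α * (β * c + w) ^ 2 : ℂ) ≠ 1 := by
  intro h
  push_cast at hw
  have hα' : (α : ℂ) ≠ 0 := by exact_mod_cast hα
  have h1 : (β * c + w) ^ 2 = (1 : ℂ) := by
    apply mul_left_cancel₀ hα'
    linear_combination h
  have h2 : (4 * β ^ 2 * (1 - c ^ 2) : ℂ) = 0 := by
    -- This is the quadratic with roots (βc ± w)²; its value at 1 is 4β²(1 - c²) > 0.
    have hroot : ((β * c + w) ^ 2) ^ 2 - (2 * β ^ 2 * c ^ 2 + 2 * w ^ 2) * (β * c + w) ^ 2 +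
      (w ^ 2 - β ^ 2 * c ^ 2) ^ 2 = (0 : ℂ) := by ring
    rw [h1, hw] at hroot
    linear_combination hroot
  have h3 : 4 * β ^ 2 * (1 - c ^ 2) = 0 := by exact_mod_cast h2
  have : 0 < 1 - c ^ 2 := by nlinarith
  have : 0 < 4 * β ^ 2 * (1 - c ^ 2) := by positivity
  linarith

/-- Some eigenvalue produced by the Friedrichs angle has modulus at least `(1 - s) / (1 + s)`. -/
theorem exists_friedrichs_eigenvalue_norm_ge {α β c s : ℝ} (hα : α ∈ Set.Ioc (0 : ℝ) 1)
    (hβ : β ∈ Set.Ioo (0 : ℝ) 1) (hc : 0 < c) (hs : 0 < s) (hcs : s ^ 2 + c ^ 2 = 1) :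
    ∃ w : ℂ, w ^ 2 = (β ^ 2 * c ^ 2 - 2 * β + 1 : ℝ) ∧
      (1 - s) / (1 + s) ≤ ‖(1 - α + α * (β * c + w) ^ 2 : ℂ)‖ := by
  have hs1 : s < 1 := by nlinarith
  obtain ⟨hα0, hα1⟩ := hα
  obtain ⟨hβ0, hβ1⟩ := hβ
  have hs1' : 0 < 1 + s := by linarith
  have hr : (1 - s) / (1 + s) = (c / (1 + s)) ^ 2 := by
    field_simp; nlinarith
  -- The discriminant w² vanishes at 1/(1 + s) and at 1/(1 - s) > 1, so on (0, 1) it changes sign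
  -- only here: w is real on the left, imaginary on the right.
  rcases le_or_gt β (1 / (1 + s)) with hle | hlt
  · set t := c / (1 + s) with ht
    have htc : t * c = 1 - s := by rw [ht]; field_simp; nlinarith
    have hbt : β * c ≤ t := by
      rw [ht, div_eq_mul_one_div, mul_comm c]; gcongr
    have hβs : β * (1 + s) ≤ 1 := by rwa [le_div_iff₀ hs1'] at hle
    -- The difference of the two sides is 2s(1/(1 + s) - β). It follows that (βc + w)² ≥ t² = ρ, and
    -- averaging with 1 preserves this.
    have hD : (t - β * c) ^ 2 ≤ β ^ 2 * c ^ 2 - 2 * β + 1 := by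
      have : t ^ 2 = 1 - 2 * (s / (1 + s)) := by rw [← hr]; field_simp; ring
      have h2 : β * s ≤ s / (1 + s) := by
        rw [le_div_iff₀ hs1']; nlinarith
      nlinarith
    have hD0 : 0 ≤ β ^ 2 * c ^ 2 - 2 * β + 1 := (sq_nonneg _).trans hD
    refine ⟨(√(β ^ 2 * c ^ 2 - 2 * β + 1) : ℝ), ?_, ?_⟩
    · rw [← Complex.ofReal_pow, Real.sq_sqrt hD0]
    · have hsq : t - β * c ≤ √(β ^ 2 * c ^ 2 - 2 * β + 1) := Real.le_sqrt_of_sq_le hD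
      set w := √(β ^ 2 * c ^ 2 - 2 * β + 1)
      have h0 : 0 ≤ t := by positivity
      have h1 : t ^ 2 ≤ (β * c + w) ^ 2 := by gcongr; linarith
      rw [hr]
      have ht1 : t ^ 2 ≤ 1 := by rw [← hr, div_le_one hs1']; linarith
      have e : (1 - α + α * (β * c + w) ^ 2 : ℂ) = ((1 - α + α * (β * c + w) ^ 2 : ℝ) : ℂ) := by
        push_cast; rfl
      rw [e, Complex.norm_real]
      refine le_trans ?_ (le_abs_self _)
      nlinarith
  · have hβs : 1 < β * (1 + s) := by rwa [div_lt_iff₀ hs1'] at hlt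
    have hD : 0 ≤ -(β ^ 2 * c ^ 2 - 2 * β + 1) := by
      have : c ^ 2 = (1 - s) * (1 + s) := by linarith
      rw [this]
      have : β * (1 - s) < 1 := by nlinarith
      nlinarith
    refine ⟨(√(-(β ^ 2 * c ^ 2 - 2 * β + 1)) : ℝ) * Complex.I, ?_, ?_⟩
    · rw [mul_pow, Complex.I_sq, ← Complex.ofReal_pow, Real.sq_sqrt hD]
      push_cast; ring
    · have hw := Real.sq_sqrt hD
      set w := √(-(β ^ 2 * c ^ 2 - 2 * β + 1))
      have e : (1 - α + α * (β * c + w * Complex.I) ^ 2 : ℂ) =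
          ((1 - α + α * (β ^ 2 * c ^ 2 - w ^ 2) : ℝ) : ℂ) +
            ((2 * α * β * c * w : ℝ) : ℂ) * Complex.I := by
        push_cast
        linear_combination (α * w ^ 2 : ℂ) * Complex.I_sq
      have hn : ‖(1 - α + α * (β * c + w * Complex.I) ^ 2 : ℂ)‖ ^ 2 =
          1 - 4 * (α * β) + 4 * (α * β) ^ 2 * s ^ 2 + 4 * (α * β) * β * c ^ 2 := by
        rw [e, ← Complex.normSq_eq_norm_sq, Complex.normSq_add_mul_I]
        have hs2 : s ^ 2 = 1 - c ^ 2 := by linarith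
        have : (1 - α + α * (β ^ 2 * c ^ 2 - w ^ 2)) ^ 2 + (2 * α * β * c * w) ^ 2 =
          (1 - α) ^ 2 + 2 * α * (1 - α) * (β ^ 2 * c ^ 2 - w ^ 2) +
            α ^ 2 * (β ^ 2 * c ^ 2 + w ^ 2) ^ 2 := by ring
        rw [this, hw, hs2]
        ring
      have hxβ : α * β ≤ β := by nlinarith
      have hx0 : 0 < α * β := by positivity
      set x := α * β
      refine le_of_sq_le_sq ?_ (norm_nonneg _)
      rw [hn]
      have hr' : (1 - s) / (1 + s) = 2 * (1 / (1 + s)) - 1 := by field_simp; ring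
      have hrs : (1 - s) / (1 + s) = 1 - 2 * s * (1 / (1 + s)) := by field_simp; ring
      have hr0 : 0 ≤ (1 - s) / (1 + s) := div_nonneg (by linarith) hs1'.le
      -- With x = αβ: for large x, β ≥ x bounds the squared modulus below by (2x - 1)²; for small x,
      -- βc² ≥ 1 - s bounds it below by (1 - 2sx)². Both squares are at least ρ², with equality at x
      -- = 1/(1 + s).
      rcases le_or_gt (1 / (1 + s)) x with hx | hx
      · have h1 : ((1 - s) / (1 + s)) ^ 2 ≤ (2 * x - 1) ^ 2 := by
          gcongr; linarith
        have h2 : 4 * x * x * c ^ 2 ≤ 4 * x * β * c ^ 2 := by gcongr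
        have h3 : s ^ 2 = 1 - c ^ 2 := by linarith
        rw [h3]
        linarith
      · have h1 : ((1 - s) / (1 + s)) ^ 2 ≤ (1 - 2 * s * x) ^ 2 := by
          gcongr
          rw [hrs]
          have := mul_le_mul_of_nonneg_left hx.le hs.le
          linarith
        have h2 : 4 * x * (1 - s) ≤ 4 * x * β * c ^ 2 := by
          have : c ^ 2 = (1 - s) * (1 + s) := by linarith
          have h3 : 1 * (1 - s) ≤ β * (1 + s) * (1 - s) := by
            apply mul_le_mul_of_nonneg_right hβs.le; linarith
          rw [this]
          nlinarith
        nlinarith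

theorem le_subdominant_aamr {s : ℝ} (hs : 0 < s) (hcs : s ^ 2 + friedrichsCos U V ^ 2 = 1)
    {α β : ℝ} (hα : α ∈ Set.Ioc (0 : ℝ) 1) (hβ : β ∈ Set.Ioo (0 : ℝ) 1) :
    (1 - s) / (1 + s) ≤ subdominant (aamr U V α β) := by
  rcases (friedrichsCos_nonneg U V).eq_or_lt with hc | hc
  · rw [← hc] at hcs
    have : s = 1 := by nlinarith
    rw [this, sub_self, zero_div]
    exact subdominant_nonneg _
  · obtain ⟨w, hw, hr⟩ := exists_friedrichs_eigenvalue_norm_ge hα hβ hc hs hcs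
    exact hr.trans (norm_le_subdominant (mem_spectrum_aamr hc hβ.1 hw)
      (friedrichs_eigenvalue_ne_one hα.1.ne' hβ.1 hc.le (friedrichsCos_lt_one U V) hw))

/-! ### Upper bound at the optimal parameters -/

/-- The roots of `z² - t z + ρ²` with `t` real, `|t| ≤ 2 ρ`, have modulus `ρ`. -/
theorem norm_le_of_quadratic {z : ℂ} {t ρ : ℝ} (hρ : 0 ≤ ρ) (ht : t ^ 2 ≤ 4 * ρ ^ 2)
    (hz : z ^ 2 - t * z + ρ ^ 2 = 0) : ‖z‖ ≤ ρ := by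
  have hre := congrArg Complex.re hz
  have him := congrArg Complex.im hz
  simp [pow_two] at hre him
  refine le_of_sq_le_sq ?_ hρ
  rw [← Complex.normSq_eq_norm_sq, Complex.normSq_apply]
  -- A real root must be the double root t/2; a nonreal one has t = 2 Re z, so the real part of the
  -- equation reads |z|² = ρ².
  rcases eq_or_ne z.im 0 with h0 | h0
  · rw [h0] at hre ⊢
    have h1 : (z.re - t / 2) ^ 2 ≤ 0 := by nlinarith
    have h2 : z.re - t / 2 = 0 := by nlinarith [sq_nonneg (z.re - t / 2)]
    nlinarith
  · have h1 : (2 * z.re - t) * z.im = 0 := by linarith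
    have h2 := (mul_eq_zero.1 h1).resolve_right h0
    obtain rfl : t = 2 * z.re := by linarith
    linarith

/-- If a vector of the complexified `U` is an eigenvector of `P_U P_V`, its eigenvalue is real,
nonnegative, and equal to `1` or at most `c_F²`. -/
theorem exists_real_eigenvalue {u : Cn n} (hu : complexProj U u = u) (hu0 : u ≠ 0) {κ : ℂ}
    (hκ : complexProj U (complexProj V u) = κ • u) :
    ∃ k : ℝ, κ = k ∧ 0 ≤ k ∧ (k = 1 ∨ k ≤ friedrichsCos U V ^ 2) := by
  have hn : (0 : ℝ) < ‖u‖ ^ 2 := by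
    have := norm_pos_iff.2 hu0
    positivity
  -- κ is the Rayleigh quotient ‖P_V u‖²/‖u‖². Being real, it has the real and imaginary parts of u
  -- as eigenvectors wherever they are nonzero.
  have h1 : κ * ((‖u‖ ^ 2 : ℝ) : ℂ) = ((‖complexProj V u‖ ^ 2 : ℝ) : ℂ) := by
    rw [← inner_complexProj_self, Complex.ofReal_pow]
    have := inner_self_eq_norm_sq_to_K (𝕜 := ℂ) u
    simp only [Complex.coe_algebraMap] at this
    rw [← this, ← inner_smul_right, ← hκ, ← inner_complexProj, hu]
  obtain ⟨k, rfl, hk0⟩ : ∃ k : ℝ, κ = k ∧ 0 ≤ k := by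
    refine ⟨‖complexProj V u‖ ^ 2 / ‖u‖ ^ 2, ?_, by positivity⟩
    rw [Complex.ofReal_div, ← h1, mul_div_cancel_right₀]
    exact_mod_cast hn.ne'
  refine ⟨k, rfl, hk0, or_iff_not_imp_left.2 fun hk1 => ?_⟩
  have hre := congrArg reVec hκ
  have him := congrArg imVec hκ
  rw [reVec_complexProj, reVec_complexProj, reVec_real_smul] at hre
  rw [imVec_complexProj, imVec_complexProj, imVec_real_smul] at him
  obtain ⟨hu1, hu2⟩ := complexProj_eq_self_iff.1 hu
  by_cases h : reVec u = 0
  · have h' : imVec u ≠ 0 := by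
      intro h'
      apply hu0
      rw [← ofRealVec_reVec_add_imVec u, h, h']
      ext i
      simp [ofRealVec]
    exact eigenvalue_le_friedrichsCos_sq hu2 h' him hk1
  · exact eigenvalue_le_friedrichsCos_sq hu1 h hre hk1

/-- Projecting the eigenvalue equation T x = z x onto U and V yields P_U P_V u = κ u for u = P_U x,
with κ = (ρ + z)²/((1 + ρ)² z). The possible values of κ then confine z. -/
theorem subdominant_aamr_le_of_pos {s : ℝ} (hs : 0 < s)
    (hcs : s ^ 2 + friedrichsCos U V ^ 2 = 1) (hc : 0 < friedrichsCos U V) :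
    subdominant (aamr U V 1 (1 / (1 + s))) ≤ (1 - s) / (1 + s) := by
  have hs1 : s < 1 := by nlinarith
  set c := friedrichsCos U V with hcdef
  set β := 1 / (1 + s) with hβ
  set ρ := (1 - s) / (1 + s) with hρ
  have hs1' : 0 < 1 + s := by linarith
  have hρ0 : 0 < ρ := div_pos (by linarith) hs1'
  have hβ0 : 0 < β := by positivity
  have hρ1 : ρ < 1 := by rw [hρ, div_lt_one hs1']; linarith
  have hβρ : 2 * β = 1 + ρ := by rw [hβ, hρ]; field_simp; ring
  have hβc : β ^ 2 * c ^ 2 = ρ := by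
    rw [hβ, hρ]; field_simp; nlinarith
  refine subdominant_le hρ0.le fun z hz hz1 => ?_
  rcases eq_or_ne z 0 with rfl | hz0
  · simpa using hρ0.le
  obtain ⟨x, hx0, hx⟩ := mem_spectrum_iff_exists_eigenvector.1 hz
  rw [toEuclideanCLM_aamr_apply] at hx
  have hρC : (ρ : ℂ) ≠ 0 := by exact_mod_cast hρ0.ne'
  have hβC : (β : ℂ) ≠ 0 := by exact_mod_cast hβ0.ne'
  have hβρC : (2 * β : ℂ) = 1 + ρ := by exact_mod_cast hβρ
  have hρ1C : (1 + ρ : ℂ) ≠ 0 := by rw [← hβρC]; exact mul_ne_zero two_ne_zero hβC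
  simp only [Complex.ofReal_one, sub_self, zero_smul, zero_add, one_smul, hβρC] at hx
  set u := complexProj U x with hu
  set v := complexProj V x with hv
  have hUu : complexProj U u = u := complexProj_complexProj U x
  have hVv : complexProj V v = v := complexProj_complexProj V x
  set y := (1 + ρ : ℂ) • u - x with hy
  have hVy : (ρ : ℂ) • complexProj V y = z • v := by
    have h := congrArg (complexProj V) hx
    rw [map_sub, map_smul, map_smul, complexProj_complexProj] at h
    rw [← h]; module
  -- Since z ≠ 1, x is recovered from its two projections.
  have hxuv : (ρ * (1 - z) : ℂ) • x = (ρ * (1 + ρ) : ℂ) • u - ((1 + ρ) * z : ℂ) • v := by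
    have h1 : (ρ : ℂ) • z • x = (1 + ρ : ℂ) • ((ρ : ℂ) • complexProj V y) - (ρ : ℂ) • y := by
      rw [← hx]; module
    rw [hVy, hy] at h1
    have h2 : (ρ * (1 - z) : ℂ) • x = (ρ : ℂ) • x - (ρ : ℂ) • z • x := by module
    rw [h2, h1]
    module
  have hPv : ((1 + ρ) * z : ℂ) • complexProj U v = (ρ * (ρ + z) : ℂ) • u := by
    have h := congrArg (complexProj U) hxuv
    rw [map_smul, map_sub, map_smul, map_smul, hUu, ← hu] at h
    have h2 : ((1 + ρ) * z : ℂ) • complexProj U v =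
      (ρ * (1 + ρ) : ℂ) • u - (ρ * (1 - z) : ℂ) • u := by rw [h]; module
    rw [h2]; module
  have hQu : (ρ * (1 + ρ) : ℂ) • complexProj V u = (ρ + z : ℂ) • v := by
    have h := congrArg (complexProj V) hxuv
    rw [map_smul, map_sub, map_smul, map_smul, hVv, ← hv] at h
    have h2 : (ρ * (1 + ρ) : ℂ) • complexProj V u =
      (ρ * (1 - z) : ℂ) • v + ((1 + ρ) * z : ℂ) • v := by rw [h]; module
    rw [h2]; module
  rcases eq_or_ne u 0 with hu0 | hu0
  · rw [hu0, map_zero, smul_zero] at hQu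
    rcases smul_eq_zero.1 hQu.symm with h | h
    · have : z = -ρ := by linear_combination h
      rw [this, norm_neg, Complex.norm_real, Real.norm_of_nonneg hρ0.le]
    · rw [hu0, h, smul_zero, smul_zero, sub_zero] at hxuv
      exact absurd hxuv (smul_ne_zero (mul_ne_zero hρC (sub_ne_zero.2 hz1.symm)) hx0)
  · have hPQ : complexProj U (complexProj V u) = ((ρ + z) ^ 2 / ((1 + ρ) ^ 2 * z) : ℂ) • u := by
      have hne : (ρ * (1 + ρ) * ((1 + ρ) * z) : ℂ) ≠ 0 :=
        mul_ne_zero (mul_ne_zero hρC hρ1C) (mul_ne_zero hρ1C hz0)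
      apply smul_right_injective _ hne
      have h := congrArg (complexProj U) hQu
      rw [map_smul, map_smul] at h
      change (ρ * (1 + ρ) * ((1 + ρ) * z) : ℂ) • complexProj U (complexProj V u) =
        (ρ * (1 + ρ) * ((1 + ρ) * z) : ℂ) • ((ρ + z) ^ 2 / ((1 + ρ) ^ 2 * z) : ℂ) • u
      calc (ρ * (1 + ρ) * ((1 + ρ) * z) : ℂ) • complexProj U (complexProj V u)
          = ((1 + ρ) * z : ℂ) • (ρ * (1 + ρ) : ℂ) • complexProj U (complexProj V u) := by module
        _ = (ρ + z : ℂ) • ((1 + ρ) * z : ℂ) • complexProj U v := by rw [h]; module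
        _ = _ := by
          rw [hPv, smul_smul, smul_smul]
          congr 1
          field_simp
    obtain ⟨k, hk, hk0, hk1⟩ := exists_real_eigenvalue hUu hu0 hPQ
    have hquad : (ρ + z) ^ 2 = (k : ℂ) * ((1 + ρ) ^ 2 * z) := by
      rw [← hk, div_mul_cancel₀]
      exact mul_ne_zero (pow_ne_zero _ hρ1C) hz0
    rcases hk1 with rfl | hkc
    · have h : (z - 1) * (z - ρ ^ 2) = 0 := by
        push_cast at hquad
        linear_combination hquad
      have h2 : z = ρ ^ 2 := sub_eq_zero.1 ((mul_eq_zero.1 h).resolve_left (sub_ne_zero.2 hz1))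
      rw [h2, norm_pow, Complex.norm_real, Real.norm_of_nonneg hρ0.le]
      nlinarith
    · refine norm_le_of_quadratic (t := (1 + ρ) ^ 2 * k - 2 * ρ) hρ0.le ?_ ?_
      -- 1 + ρ = 2β and β²c² = ρ give (1 + ρ)²c² = 4ρ, so t = (1 + ρ)²k - 2ρ lies in [-2ρ, 2ρ].
      · have h1 : (1 + ρ) ^ 2 * k ≤ 4 * ρ := by
          calc (1 + ρ) ^ 2 * k ≤ (1 + ρ) ^ 2 * c ^ 2 := by gcongr
            _ = 4 * ρ := by rw [← hβρ, ← hβc]; ring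
        have h2 : 0 ≤ (1 + ρ) ^ 2 * k := by positivity
        nlinarith
      · push_cast
        linear_combination hquad

/-! ### The right angle, and the Jordan block otherwise -/

/-- If the Friedrichs angle is right, `T_{1,1/2}` is idempotent. -/
theorem aamr_mul_self_of_friedrichsCos_eq_zero (hc : friedrichsCos U V = 0) :
    aamr U V 1 (1 / 2) * aamr U V 1 (1 / 2) = aamr U V 1 (1 / 2) := by
  have hcomm : ∀ x : Cn n,
      complexProj U (complexProj V x) = complexProj V (complexProj U x) := by
    have hr : ∀ a : En n, U.starProjection (V.starProjection a) =
        V.starProjection (U.starProjection a) := by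
      intro a
      rw [starProjection_comp_of_friedrichsCos_eq_zero hc,
        starProjection_comp_of_friedrichsCos_eq_zero (friedrichsCos_comm U V ▸ hc)]
      simp only [inf_comm V U]
    intro x
    apply eq_of_reVec_imVec
    · simp only [reVec_complexProj, hr]
    · simp only [imVec_complexProj, hr]
  apply EquivLike.injective (Matrix.toEuclideanCLM (n := Fin n) (𝕜 := ℂ))
  rw [map_mul]
  refine ContinuousLinearMap.ext fun x => ?_
  have hT : ∀ x : Cn n, Matrix.toEuclideanCLM (n := Fin n) (𝕜 := ℂ) (aamr U V 1 (1 / 2)) x =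
      complexProj V (complexProj U x) - complexProj V x - complexProj U x + x := by
    intro x
    rw [toEuclideanCLM_aamr_apply]
    have : (2 * ((1 / 2 : ℝ) : ℂ)) = 1 := by push_cast; norm_num
    rw [this, one_smul, one_smul, map_sub]
    push_cast
    module
  rw [mul_apply_eq_comp, hT, hT]
  simp only [map_add, map_sub, hcomm, complexProj_complexProj]
  module

theorem subdominant_eq_zero_of_mul_self {A : Matrix (Fin n) (Fin n) ℂ} (hA : A * A = A) :
    subdominant A = 0 := by
  refine le_antisymm (subdominant_le le_rfl fun z hz hz1 => ?_) (subdominant_nonneg A)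
  obtain ⟨x, hx0, hx⟩ := mem_spectrum_iff_exists_eigenvector.1 hz
  have h : (z * (z - 1)) • x = 0 := by
    have h2 := congrArg (fun B => Matrix.toEuclideanCLM (n := Fin n) (𝕜 := ℂ) B x) hA
    simp only [map_mul, mul_apply_eq_comp, hx, map_smul] at h2
    rw [mul_sub, mul_one, sub_smul, mul_smul, h2, sub_self]
  have h3 := (mul_eq_zero.1 ((smul_eq_zero.1 h).resolve_right hx0)).resolve_right
    (sub_ne_zero.2 hz1)
  rw [h3, norm_zero]

theorem zero_mem_linearRates_of_mul_self {A : Matrix (Fin n) (Fin n) ℂ} (hA : A * A = A) :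
    (0 : ℝ) ∈ linearRates A := by
  -- The limit is A itself, and k₀ = 1 because A^k = A is only available from k = 1.
  refine ⟨A, le_rfl, one_pos, 1, one_pos, 1, one_pos, fun k hk => ?_⟩
  have hidem : IsIdempotentElem A := hA
  obtain ⟨j, rfl⟩ : ∃ j, k = j + 1 := ⟨k - 1, by omega⟩
  rw [hidem.pow_succ_eq, sub_self, inducedNorm, map_zero, norm_zero]
  positivity

theorem subdominant_aamr_eq {s : ℝ} (hs : 0 < s) (hcs : s ^ 2 + friedrichsCos U V ^ 2 = 1)
    (hβ : 1 / (1 + s) ∈ Set.Ioo (0 : ℝ) 1) :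
    (1 - s) / (1 + s) = subdominant (aamr U V 1 (1 / (1 + s))) := by
  refine le_antisymm (le_subdominant_aamr hs hcs ⟨one_pos, le_rfl⟩ hβ) ?_
  rcases (friedrichsCos_nonneg U V).eq_or_lt with hc | hc
  · have h1 : s = 1 := by rw [← hc] at hcs; nlinarith
    rw [h1, one_add_one_eq_two, sub_self, zero_div,
      subdominant_eq_zero_of_mul_self (aamr_mul_self_of_friedrichsCos_eq_zero hc.symm)]
  · exact subdominant_aamr_le_of_pos hs hcs hc

/-- If the Friedrichs angle is not right, the minimal `γ` is not a linear convergence rate. -/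
theorem notMem_linearRates_aamr {s : ℝ} (hs : 0 < s) (hcs : s ^ 2 + friedrichsCos U V ^ 2 = 1)
    (hc : 0 < friedrichsCos U V) :
    (1 - s) / (1 + s) ∉ linearRates (aamr U V 1 (1 / (1 + s))) := by
  obtain ⟨u, v, hu1, hv1, hu, hv, huv, hvu⟩ := exists_complex_principal_vectors hc
  have hs1 : s < 1 := by nlinarith
  set c := friedrichsCos U V with hcdef
  set β := 1 / (1 + s) with hβ
  set ρ := (1 - s) / (1 + s) with hρ
  have hs1' : 0 < 1 + s := by linarith
  have hρ0 : 0 < ρ := div_pos (by linarith) hs1'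
  have hβ0 : 0 < β := by positivity
  have hρ1 : ρ < 1 := by rw [hρ, div_lt_one hs1']; linarith
  have hβρ : 2 * β - 1 = ρ := by rw [hβ, hρ]; field_simp; ring
  have hβc : β ^ 2 * c ^ 2 = ρ := by
    rw [hβ, hρ]; field_simp; nlinarith
  have hβρC : (2 * β - 1 : ℂ) = ρ := by exact_mod_cast hβρ
  have hβcC : (β ^ 2 * c ^ 2 : ℂ) = ρ := by exact_mod_cast hβc
  -- e = (T - ρ)u. It is nonzero because ‖βc v‖² = ρ < 1 = ‖u‖².
  refine notMem_linearRates_of_jordan (e := (2 * ρ : ℂ) • ((β * c : ℂ) • v - u)) (f := u) hρ0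
    ?_ ?_ ?_
  · have hρC : (2 * ρ : ℂ) ≠ 0 := by exact_mod_cast (by positivity : 2 * ρ ≠ 0)
    refine smul_ne_zero hρC fun h => ?_
    have h1 := congrArg norm (sub_eq_zero.1 h)
    have h2 : (β * c) ^ 2 = 1 := by
      rw [norm_smul, hu1, hv1, mul_one, ← Complex.ofReal_mul, Complex.norm_real,
        Real.norm_of_nonneg (by positivity)] at h1
      rw [h1, one_pow]
    rw [mul_pow, hβc] at h2
    linarith
  · rw [map_smul, map_sub, map_smul, aamr_apply_fst hu huv, aamr_apply_snd hv huv hvu, hβρC]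
    have e1 : (4 * β ^ 2 * c ^ 2 : ℂ) = 4 * ρ := by rw [← hβcC]; ring
    rw [e1]
    have e2 : (2 * ρ : ℂ) • ((β * c : ℂ) •
        ((-((1 : ℝ) * (2 * β * c)) : ℂ) • u + (1 - (1 : ℝ) + (1 : ℝ) * (4 * ρ - ρ) : ℂ) • v) -
        ((1 - (1 : ℝ) - (1 : ℝ) * ρ : ℂ) • u + ((1 : ℝ) * ρ * (2 * β * c) : ℂ) • v)) =
        (2 * ρ * (ρ - 2 * (β ^ 2 * c ^ 2)) : ℂ) • u + (2 * ρ * (ρ * β * c) : ℂ) • v := by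
      push_cast; module
    rw [e2, hβcC]
    module
  · rw [aamr_apply_fst hu huv, hβρC]
    push_cast
    module

end Aamr

theorem theorem3p2 {n : ℕ} (U V : Submodule ℝ (En n))
    (hU : 1 ≤ Module.finrank ℝ U)
    (hUV : Module.finrank ℝ U ≤ Module.finrank ℝ V)
    (hV : Module.finrank ℝ V + 1 ≤ n)
    (hne : U ≠ U ⊓ V)
    (hbot : U ⊓ V ≠ ⊥)
    (θ βs : ℝ) (hθ : θ = friedrichsAngle U V) (hβs : βs = 1 / (1 + Real.sin θ)) :
    -- `γ(T_{α,β})` is the infimum of the linear convergence rates of `T_{α,β}`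
    (∀ α ∈ Set.Ioc (0 : ℝ) 1, ∀ β ∈ Set.Ioo (0 : ℝ) 1,
      IsGLB (linearRates (aamr U V α β)) (subdominant (aamr U V α β))) ∧
    -- the minimizer lies in the parameter domain
    βs ∈ Set.Ioo (0 : ℝ) 1 ∧
    -- the minimal value
    (1 - Real.sin θ) / (1 + Real.sin θ) = subdominant (aamr U V 1 βs) ∧
    -- minimality
    (∀ α ∈ Set.Ioc (0 : ℝ) 1, ∀ β ∈ Set.Ioo (0 : ℝ) 1,
      subdominant (aamr U V 1 βs) ≤ subdominant (aamr U V α β)) ∧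
    (IsOptimalLinearRate (aamr U V 1 βs) (subdominant (aamr U V 1 βs)) ↔
      θ = Real.pi / 2) := by
  have hc0 := friedrichsCos_nonneg U V
  have hc1 := friedrichsCos_lt_one U V
  have hpos : 0 < 1 - friedrichsCos U V ^ 2 := by nlinarith
  have hsin : Real.sin θ = √(1 - friedrichsCos U V ^ 2) := by
    rw [hθ, friedrichsAngle, Real.sin_arccos]
  have hs : 0 < Real.sin θ := hsin ▸ Real.sqrt_pos.2 hpos
  have hcs : Real.sin θ ^ 2 + friedrichsCos U V ^ 2 = 1 := by
    rw [hsin, Real.sq_sqrt hpos.le]; ring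
  have hβ : βs ∈ Set.Ioo (0 : ℝ) 1 := by
    rw [hβs]
    exact ⟨by positivity, by rw [div_lt_one (by positivity)]; linarith⟩
  have hγ : (1 - Real.sin θ) / (1 + Real.sin θ) = subdominant (aamr U V 1 βs) := by
    rw [hβs] at hβ ⊢
    exact subdominant_aamr_eq hs hcs hβ
  refine ⟨fun α hα β hβ => isGLB_linearRates_aamr hα hβ, hβ, hγ, fun α hα β hβ => ?_, ?_⟩
  · rw [← hγ]
    exact le_subdominant_aamr hs hcs hα hβ
  · rw [hθ, friedrichsAngle, Real.arccos_eq_pi_div_two]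
    constructor
    · intro hopt
      by_contra hne0
      have hmem := hopt.2
      rw [← hγ, hβs] at hmem
      exact notMem_linearRates_aamr hs hcs (lt_of_le_of_ne hc0 (Ne.symm hne0)) hmem
    · intro hc
      refine ⟨isGLB_linearRates_aamr ⟨one_pos, le_rfl⟩ hβ, ?_⟩
      have hs1 : Real.sin θ = 1 := by rw [hsin, hc]; simp
      have hβ2 : βs = 1 / 2 := by rw [hβs, hs1]; norm_num
      have hidem := aamr_mul_self_of_friedrichsCos_eq_zero hc
      rw [hβ2, subdominant_eq_zero_of_mul_self hidem]
      exact zero_mem_linearRates_of_mul_self hidem
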